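/- Let $\mathbb T\subseteq\mathbb R$ be a time scale (a nonempty closed set) with forward jump $\sigma(t)=\inf\{s\in\mathbb T: s>t\}$, backward jump $\rho(t)=\sup\{s\in\mathbb T:s<t\}$ (where $\inf\emptyset=\sup\mathbb T$, $\sup\emptyset=\inf\mathbb T$) and graininess $\mu(t)=\sigma(t)-t$, let $\mathbb T^\kappa$ be $\mathbb T$ with its maximum removed if that maximum is left-scattered ($\rho(t)<t$), and let $x^\Delta$ denote the delta (Hilger) derivative. Let $\mu_{\max}$ be a constant with $\mu(t)\le\mu_{\max}$ for all $t\in\mathbb T$. A function $p:\mathbb T\to\mathbb R$ is rd-continuous if it is continuous at all $t$ with $\sigma(t)=t$ and has finite left-hand limits at all $t$ with $\rho(t)=t$; it belongs to $\mathcal R$ (resp. $\mathcal R^+$) if it is rd-continuous and $1+\mu(t)p(t)\ne0$ (resp. $>0$) for all $t\in\mathbb T^\kappa$. For $p\in\mathcal R$, $e_p(\cdot,t_0)$ denotes the unique solution of $y^\Delta=p\,y$ on $\mathbb T^\kappa$, $y(t_0)=1$. For a matrix function $M:\mathbb T\to\mathbb R^{n\times n}$, the equation $x^\Delta=M(t)x$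 is called uniformly exponentially stable with rate $r$ if $r>0$, $-r\in\mathcal R^+$, and there is a constant $\gamma>0$ such that for all $t_0\in\mathbb T$ and $x_0\in\mathbb R^n$ the solution with $x(t_0)=x_0$ satisfies $$\|x(t)\|\le\gamma\,e_{-r}(t,t_0)\,\|x_0\|\qquad\text{for all }t\in\mathbb T,\ t\ge t_0,$$ where $\|\cdot\|$ is the Euclidean norm. **Lemma (stability under state variable change).** Let $A:\mathbb T\to\mathbb R^{n\times n}$ be rd-continuous (entrywise) and regressive, that is, $1+\mu(t)z\neq0$ for all $t\in\mathbb T^\kappa$ and every complex eigenvalue $z$ of $A(t)$. Let $\lambda,\alpha>0$ with $-\lambda\in\mathcal R^+$. If $$z^\Delta=[A(t)(1+\mu(t)\alpha)+\alpha I]\,z$$ is uniformly exponentially stable with rate $\lambda$, then $x^\Delta=A(t)x$ is uniformly exponentially stable with rate $\dfrac{\lambda+\alpha}{1+\mu_{\max}\alpha}$. -/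

import Mathlib

open Filter Topology

noncomputable section

namespace TimeScale

/-- A time scale: a nonempty closed subset of the real line. -/
structure IsTimeScale (T : Set ℝ) : Prop where
  nonempty : T.Nonempty
  isClosed : IsClosed T

open Classical in
/-- Forward jump operator `σ(t) = inf {s ∈ T : s > t}`, with the usual convention `σ(t) = t` when
`t` is the maximum of `T` (that is, `inf ∅ = sup T`). -/
def sigma (T : Set ℝ) (t : ℝ) : ℝ :=
  if (T ∩ Set.Ioi t).Nonempty then sInf (T ∩ Set.Ioi t) else t

open Classical in
/-- Backward jump operator `ρ(t) = sup {s ∈ T : s < t}`, with the usual convention `ρ(t) = t` when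
`t` is the minimum of `T` (that is, `sup ∅ = inf T`). -/
def rho (T : Set ℝ) (t : ℝ) : ℝ :=
  if (T ∩ Set.Iio t).Nonempty then sSup (T ∩ Set.Iio t) else t

/-- Graininess `μ(t) = σ(t) - t`. -/
def mu (T : Set ℝ) (t : ℝ) : ℝ := sigma T t - t

/-- `T^κ`: the time scale with its maximum removed if that maximum is left-scattered. -/
def kappa (T : Set ℝ) : Set ℝ := {t | t ∈ T ∧ ¬ (IsGreatest T t ∧ rho T t < t)}

/-- `f' = f^Δ(t)`: for every `ε > 0`, the inequality
`‖[f(σ(t)) - f(s)] - f' [σ(t) - s]‖ ≤ ε |σ(t) - s|` holds for all `s ∈ T` in a neighbourhood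
of `t`. Only the values of `f` on `T` matter (for `t ∈ T`). -/
def HasDeltaDeriv {E : Type*} [NormedAddCommGroup E] [NormedSpace ℝ E]
    (T : Set ℝ) (f : ℝ → E) (f' : E) (t : ℝ) : Prop :=
  ∀ ε : ℝ, 0 < ε → ∀ᶠ s in 𝓝[T] t,
    ‖(f (sigma T t) - f s) - (sigma T t - s) • f'‖ ≤ ε * |sigma T t - s|

/-- Rd-continuity on `T`: continuity (relative to `T`) at right-dense points and existence of a
finite left-hand limit (relative to `T`) at left-dense points. -/
def RdContinuous (T : Set ℝ) (p : ℝ → ℝ) : Prop :=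
  (∀ t ∈ T, sigma T t = t → ContinuousWithinAt p T t) ∧
  (∀ t ∈ T, rho T t = t → ∃ l : ℝ, Tendsto p (𝓝[T ∩ Set.Iio t] t) (𝓝 l))

/-- The set `R` of regressive functions. -/
def Regressive (T : Set ℝ) (p : ℝ → ℝ) : Prop :=
  RdContinuous T p ∧ ∀ t ∈ kappa T, 1 + mu T t * p t ≠ 0

/-- The set `R⁺` of positively regressive functions. -/
def PosRegressive (T : Set ℝ) (p : ℝ → ℝ) : Prop :=
  Regressive T p ∧ ∀ t ∈ kappa T, 0 < 1 + mu T t * p t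

/-- A matrix function is rd-continuous if each of its entries is. -/
def MatrixRdContinuous {n : ℕ} (T : Set ℝ) (A : ℝ → Matrix (Fin n) (Fin n) ℝ) : Prop :=
  ∀ i j, RdContinuous T (fun t => A t i j)

/-- A matrix function is regressive if all its (complex) eigenvalues `z` satisfy
`1 + μ(t) z ≠ 0` at every `t ∈ T^κ`. -/
def MatrixRegressive {n : ℕ} (T : Set ℝ) (A : ℝ → Matrix (Fin n) (Fin n) ℝ) : Prop :=
  ∀ t ∈ kappa T, ∀ z ∈ spectrum ℂ ((A t).map (fun a : ℝ => (a : ℂ))),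
    1 + (mu T t : ℂ) * z ≠ 0

/-- `y` solves the dynamic initial value problem `y^Δ = p y` on `T^κ`, `y(s) = 1`. -/
def IsExpSolution (T : Set ℝ) (p : ℝ → ℝ) (s : ℝ) (y : ℝ → ℝ) : Prop :=
  y s = 1 ∧ ∀ t ∈ kappa T, HasDeltaDeriv T y (p t * y t) t

/-- The time scale exponential `e_p(t, s)`: the solution of `y^Δ = p y`, `y(s) = 1`, evaluated at
`t`. For regressive `p` and `s, t ∈ T` the solution exists and its value at `t` is unique. -/
def expo (T : Set ℝ) (p : ℝ → ℝ) (t s : ℝ) : ℝ :=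
  Classical.epsilon (IsExpSolution T p s) t

/-- `x` solves the homogeneous linear equation `x^Δ(t) = A(t) x(t)`, `t ∈ T^κ`. -/
def IsSolution {n : ℕ} (T : Set ℝ) (A : ℝ → Matrix (Fin n) (Fin n) ℝ)
    (x : ℝ → EuclideanSpace ℝ (Fin n)) : Prop :=
  ∀ t ∈ kappa T, HasDeltaDeriv T x (Matrix.toEuclideanLin (A t) (x t)) t

/-- Uniform exponential stability of `x^Δ = A(t) x` with rate `r`: `r > 0`, `-r ∈ R⁺`, and there is
`γ > 0` such that for all `t₀ ∈ T` and `x₀` the solution with `x(t₀) = x₀` satisfies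
`‖x(t)‖ ≤ γ e_{-r}(t, t₀) ‖x₀‖` for `t ≥ t₀` in `T`. -/
def UniformlyExpStable {n : ℕ} (T : Set ℝ) (A : ℝ → Matrix (Fin n) (Fin n) ℝ) (r : ℝ) : Prop :=
  0 < r ∧ PosRegressive T (fun _ => -r) ∧
  ∃ γ : ℝ, 0 < γ ∧
    ∀ t₀ ∈ T, ∀ (x₀ : EuclideanSpace ℝ (Fin n)) (x : ℝ → EuclideanSpace ℝ (Fin n)),
      IsSolution T A x → x t₀ = x₀ →
        ∀ t ∈ T, t₀ ≤ t → ‖x t‖ ≤ γ * expo T (fun _ => -r) t t₀ * ‖x₀‖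

end TimeScale

end

/-!
Multiplying a solution `x` of `x^Δ = A x` by the exponential `e_α(·, t₀)` gives, by the product
rule, a solution `z` of `z^Δ = [A (1 + μ α) + α I] z` with `z t₀ = x t₀`
(`IsSolution.expFun_smul`). Stability of the second equation therefore yields
`‖x t‖ ≤ γ e_{-λ}(t, t₀) / e_α(t, t₀) ‖x t₀‖`, and it remains to compare `e_{-λ} / e_α` with
`e_{-r}` for `r = (λ + α) / (1 + μmax α)`. Since `r (1 + μ α) ≤ λ + α`, one has
`1 - μ λ ≤ (1 + μ α) (1 - μ r)`, which shows both that `-r` is positively regressive and that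
`e_{-λ} ≤ e_α e_{-r}` forward in time (`expFun_le_mul`).

The value `expo T p t t₀` is specified only as that of some solution, so the comparison needs
existence and forward uniqueness for a constant positively regressive `p`.

* Existence: `expFun T p t₀ t` is the exponential of the Lebesgue integral from `t₀` to `t` of
  `log (1 + h p) / h`, where `h` is the length of the gap of `T` around the point of integration
  (the integrand is `p` on `T`). A gap around a point between `s` and `t` in `T` is at most
  `|s - t|` long, so the exponent is differentiable along `T` with derivative `p`
  (`hasDerivWithinAt_integral_cyl_gap`), while crossing a gap multiplies the exponential by
  `1 + μ p` (`expFun_sigma`). The integrand is bounded because a compact interval contains a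
  longest gap (`exists_gap_le`).
* Uniqueness: the quotient of two solutions has zero delta derivative and is therefore constant
  (`eq_of_hasDeltaDeriv_zero`).
-/

namespace TimeScale

variable {T : Set ℝ} {E : Type*} [NormedAddCommGroup E] [NormedSpace ℝ E]

/-! ### Jump operators -/

lemma sigma_le {b t : ℝ} (hb : b ∈ T) (htb : t < b) : sigma T t ≤ b := by
  have hne : (T ∩ Set.Ioi t).Nonempty := ⟨b, hb, htb⟩
  rw [sigma, if_pos hne]
  exact csInf_le ⟨t, fun _ hs => hs.2.le⟩ ⟨hb, htb⟩

lemma le_sigma (T : Set ℝ) (t : ℝ) : t ≤ sigma T t := by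
  unfold sigma
  split_ifs with h
  · exact le_csInf h fun _ hs => hs.2.le
  · exact le_rfl

lemma mu_nonneg (T : Set ℝ) (t : ℝ) : 0 ≤ mu T t := sub_nonneg.2 (le_sigma T t)

lemma sigma_mem (hT : IsClosed T) {t : ℝ} (ht : t ∈ T) : sigma T t ∈ T := by
  unfold sigma
  split_ifs with h
  · have hcl := csInf_mem_closure h ⟨t, fun _ hs => hs.2.le⟩
    exact hT.closure_subset (closure_mono Set.inter_subset_left hcl)
  · exact ht

lemma mem_kappa_of_lt {b t : ℝ} (ht : t ∈ T) (hb : b ∈ T) (htb : t < b) : t ∈ kappa T :=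
  ⟨ht, fun h => (h.1.2 hb).not_gt htb⟩

lemma exists_mem_Ioo_of_sigma_eq {b d t : ℝ} (hb : b ∈ T) (htb : t < b) (htd : t < d)
    (h : sigma T t = t) : ∃ s ∈ T, t < s ∧ s < d := by
  have hne : (T ∩ Set.Ioi t).Nonempty := ⟨b, hb, htb⟩
  rw [sigma, if_pos hne] at h
  obtain ⟨s, hs, hsd⟩ := exists_lt_of_csInf_lt hne (h.trans_lt htd)
  exact ⟨s, hs.1, hs.2, hsd⟩

/-! ### Calculus of the delta derivative -/

lemma hasDeltaDeriv_iff_of_sigma_eq {f : ℝ → E} {f' : E} {t : ℝ} (h : sigma T t = t) :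
    HasDeltaDeriv T f f' t ↔ HasDerivWithinAt f f' T t := by
  rw [hasDerivWithinAt_iff_isLittleO, Asymptotics.isLittleO_iff, HasDeltaDeriv, h]
  refine forall₂_congr fun ε _ => ?_
  refine eventually_congr (Eventually.of_forall fun s => ?_)
  rw [← norm_neg (f s - f t - (s - t) • f'), Real.norm_eq_abs, abs_sub_comm s t]
  congr! 2
  module

lemma hasDeltaDeriv_iff_of_lt_sigma {f : ℝ → E} {f' : E} {t : ℝ} (ht : t ∈ T)
    (h : t < sigma T t) :
    HasDeltaDeriv T f f' t ↔ ContinuousWithinAt f T t ∧ f (sigma T t) = f t + mu T t • f' := by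
  have hlin : Tendsto (fun s => (sigma T t - s) • f') (𝓝[T] t) (𝓝 (mu T t • f')) := by
    have : Continuous fun s : ℝ => (sigma T t - s) • f' := by fun_prop
    exact (this.tendsto t).mono_left nhdsWithin_le_nhds
  constructor
  · intro hd
    -- the defining inequality says that `f s` tends to `f (σ t) - μ t • f'`; then `t ∈ T`
    -- identifies this limit with `f t`
    have hlim : Tendsto (fun s => (f (sigma T t) - f s) - (sigma T t - s) • f') (𝓝[T] t)
        (𝓝 0) := by
      rw [Metric.tendsto_nhds]
      intro δ hδ
      have hpos : 0 < sigma T t - t + 1 := by linarith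
      have hb : ∀ᶠ s in 𝓝[T] t, |sigma T t - s| < sigma T t - t + 1 := by
        have hc : ContinuousAt (fun s : ℝ => |sigma T t - s|) t := by fun_prop
        refine nhdsWithin_le_nhds (hc.eventually_lt_const ?_)
        simp only [abs_of_pos (sub_pos.2 h)]
        linarith
      filter_upwards [hd (δ / (sigma T t - t + 1)) (by positivity), hb] with s h1 h2
      rw [dist_zero_right]
      refine h1.trans_lt ?_
      calc _ < δ / (sigma T t - t + 1) * (sigma T t - t + 1) := by gcongr
        _ = δ := by field_simp
    have hf : Tendsto f (𝓝[T] t) (𝓝 (f (sigma T t) - mu T t • f')) := by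
      have := (tendsto_const_nhds (x := f (sigma T t))).sub (hlim.add hlin)
      simpa using this
    have hval : f t = f (sigma T t) - mu T t • f' :=
      tendsto_nhds_unique (tendsto_pure_nhds f t) (hf.mono_left (pure_le_nhdsWithin ht))
    refine ⟨?_, ?_⟩
    · rw [ContinuousWithinAt, hval]
      exact hf
    · rw [hval]
      abel
  · rintro ⟨hc, hσ⟩ ε hε
    have h1 : Tendsto (fun s => ‖(f (sigma T t) - f s) - (sigma T t - s) • f'‖) (𝓝[T] t)
        (𝓝 0) := by
      have := (((tendsto_const_nhds (x := f (sigma T t))).sub hc).sub hlin).norm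
      rwa [hσ, add_sub_cancel_left, sub_self, norm_zero, ← hσ] at this
    have h2 : Tendsto (fun s => ε * |sigma T t - s|) (𝓝[T] t) (𝓝 (ε * |sigma T t - t|)) := by
      have : Continuous fun s : ℝ => ε * |sigma T t - s| := by fun_prop
      exact (this.tendsto t).mono_left nhdsWithin_le_nhds
    have h3 : 0 < ε * |sigma T t - t| := mul_pos hε (abs_pos.2 (sub_pos.2 h).ne')
    filter_upwards [h1.eventually_lt h2 h3] with s hs using hs.le

lemma HasDeltaDeriv.continuousWithinAt {f : ℝ → E} {f' : E} {t : ℝ} (ht : t ∈ T)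
    (h : HasDeltaDeriv T f f' t) : ContinuousWithinAt f T t := by
  rcases (le_sigma T t).eq_or_lt with hσ | hσ
  · exact ((hasDeltaDeriv_iff_of_sigma_eq hσ.symm).1 h).continuousWithinAt
  · exact ((hasDeltaDeriv_iff_of_lt_sigma ht hσ).1 h).1

lemma HasDeltaDeriv.apply_sigma {f : ℝ → E} {f' : E} {t : ℝ} (ht : t ∈ T)
    (h : HasDeltaDeriv T f f' t) : f (sigma T t) = f t + mu T t • f' := by
  rcases (le_sigma T t).eq_or_lt with hσ | hσ
  · simp [mu, ← hσ]
  · exact ((hasDeltaDeriv_iff_of_lt_sigma ht hσ).1 h).2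

/-- Product rule for a scalar function times a vector function. -/
lemma HasDeltaDeriv.smul {w : ℝ → ℝ} {w' : ℝ} {f : ℝ → E} {f' : E} {t : ℝ} (ht : t ∈ T)
    (hw : HasDeltaDeriv T w w' t) (hf : HasDeltaDeriv T f f' t) :
    HasDeltaDeriv T (fun s => w s • f s) (w (sigma T t) • f' + w' • f t) t := by
  rcases (le_sigma T t).eq_or_lt with hσ | hσ
  · rw [hasDeltaDeriv_iff_of_sigma_eq hσ.symm] at hw hf ⊢
    rw [← hσ]
    exact hw.smul hf
  · rw [hasDeltaDeriv_iff_of_lt_sigma ht hσ] at hw hf ⊢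
    refine ⟨hw.1.smul hf.1, ?_⟩
    rw [hf.2, hw.2]
    simp only [smul_eq_mul]
    module

/-- A function with vanishing delta derivative is constant. -/
lemma eq_of_hasDeltaDeriv_zero (hT : IsClosed T) {u : ℝ → ℝ} {a b : ℝ} (ha : a ∈ T)
    (hb : b ∈ T) (hab : a ≤ b) (hd : ∀ t ∈ kappa T, HasDeltaDeriv T u 0 t) : u b = u a := by
  suffices h : ∀ ε : ℝ, 0 < ε → |u b - u a| ≤ ε * (b - a) by
    have h0 : |u b - u a| ≤ 0 := by
      refine le_of_forall_pos_le_add fun δ hδ => ?_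
      have hpos : 0 < b - a + 1 := by linarith
      refine (h (δ / (b - a + 1)) (by positivity)).trans ?_
      rw [zero_add, div_mul_eq_mul_div, div_le_iff₀ hpos]
      nlinarith
    exact sub_eq_zero.1 (abs_nonpos_iff.1 h0)
  intro ε hε
  -- the last point `c` of `[a, b]` at which the estimate holds is `b`
  set S : Set ℝ := {t | t ∈ T ∧ a ≤ t ∧ t ≤ b ∧ |u t - u a| ≤ ε * (t - a)}
  have haS : a ∈ S := ⟨ha, le_rfl, hab, by simp⟩
  have hbdd : BddAbove S := ⟨b, fun t ht => ht.2.2.1⟩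
  set c := sSup S
  have hcl : c ∈ closure S := csSup_mem_closure ⟨a, haS⟩ hbdd
  have hST : S ⊆ T := fun t ht => ht.1
  have hcT : c ∈ T := hT.closure_subset (closure_mono hST hcl)
  have hac : a ≤ c := le_csSup hbdd haS
  have hcb : c ≤ b := csSup_le ⟨a, haS⟩ fun t ht => ht.2.2.1
  have hcS : c ∈ S := by
    by_contra hcS
    have hck : c ∈ kappa T := by
      refine ⟨hcT, fun h => ?_⟩
      obtain ⟨s, hs, hρs⟩ := exists_lt_of_lt_csSup ⟨a, haS⟩ h.2
      have hsc : s < c := lt_of_le_of_ne (le_csSup hbdd hs) (ne_of_mem_of_not_mem hs hcS)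
      have hne : (T ∩ Set.Iio c).Nonempty := ⟨s, hs.1, hsc⟩
      rw [rho, if_pos hne] at hρs
      exact hρs.not_ge (le_csSup ⟨c, fun _ hx => hx.2.le⟩ ⟨hs.1, hsc⟩)
    have hcont : ContinuousWithinAt u S c := ((hd c hck).continuousWithinAt hcT).mono hST
    refine hcS ⟨hcT, hac, hcb, ?_⟩
    refine ContinuousWithinAt.closure_le hcl (hcont.sub continuousWithinAt_const).abs ?_
      fun t ht => ht.2.2.2
    fun_prop
  rcases hcb.eq_or_lt with h | hlt
  · rw [← h]
    exact hcS.2.2.2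
  exfalso
  have hck := mem_kappa_of_lt hcT hb hlt
  -- from `c < b` the estimate propagates to a later point
  suffices h : ∃ s ∈ T, c < s ∧ s ≤ b ∧ |u s - u c| ≤ ε * (s - c) by
    obtain ⟨s, hsT, hcs, hsb, hs⟩ := h
    refine hcs.not_ge (le_csSup hbdd ⟨hsT, hac.trans hcs.le, hsb, ?_⟩)
    have := abs_sub_le (u s) (u c) (u a)
    have := hcS.2.2.2
    linarith
  rcases (le_sigma T c).eq_or_lt with hσ | hσ
  · have hev := hd c hck ε hε
    rw [← hσ, eventually_nhdsWithin_iff, Metric.eventually_nhds_iff] at hev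
    obtain ⟨δ, hδ, hev⟩ := hev
    obtain ⟨s, hsT, hcs, hs⟩ := exists_mem_Ioo_of_sigma_eq hb hlt
      (lt_min hlt (lt_add_of_pos_right c hδ)) hσ.symm
    obtain ⟨hsb, hsδ⟩ := lt_min_iff.1 hs
    refine ⟨s, hsT, hcs, hsb.le, ?_⟩
    have hdist : dist s c < δ := by
      rw [Real.dist_eq, abs_of_pos (sub_pos.2 hcs)]
      linarith
    have := hev hdist hsT
    rw [smul_zero, sub_zero, Real.norm_eq_abs, abs_sub_comm, abs_sub_comm c,
      abs_of_pos (sub_pos.2 hcs)] at this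
    exact this
  · refine ⟨sigma T c, sigma_mem hT hcT, hσ, sigma_le hb hlt, ?_⟩
    rw [(hd c hck).apply_sigma hcT, smul_zero, add_zero, sub_self, abs_zero]
    exact mul_nonneg hε.le (sub_nonneg.2 hσ.le)

/-! ### Gaps -/

/-- The last point of `T` at or before `s` (for `s` between two points of `T`). -/
noncomputable def leftEnd (T : Set ℝ) (s : ℝ) : ℝ := sSup (T ∩ Set.Iic s)

/-- The first point of `T` at or after `s` (for `s` between two points of `T`). -/
noncomputable def rightEnd (T : Set ℝ) (s : ℝ) : ℝ := sInf (T ∩ Set.Ici s)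

/-- The length of the gap of `T` around `s`; it is `0` when `s ∈ T`. It is only meaningful for `s`
between two points of `T`. -/
noncomputable def gap (T : Set ℝ) (s : ℝ) : ℝ := rightEnd T s - leftEnd T s

lemma leftEnd_mem (hT : IsClosed T) {a s : ℝ} (ha : a ∈ T) (has : a ≤ s) :
    leftEnd T s ∈ T ∩ Set.Iic s :=
  (hT.inter isClosed_Iic).csSup_mem ⟨a, ha, has⟩ ⟨s, fun _ h => h.2⟩

lemma rightEnd_mem (hT : IsClosed T) {b s : ℝ} (hb : b ∈ T) (hsb : s ≤ b) :
    rightEnd T s ∈ T ∩ Set.Ici s :=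
  (hT.inter isClosed_Ici).csInf_mem ⟨b, hb, hsb⟩ ⟨s, fun _ h => h.2⟩

lemma le_leftEnd {a s : ℝ} (ha : a ∈ T) (has : a ≤ s) : a ≤ leftEnd T s :=
  le_csSup ⟨s, fun _ h => h.2⟩ ⟨ha, has⟩

lemma rightEnd_le {b s : ℝ} (hb : b ∈ T) (hsb : s ≤ b) : rightEnd T s ≤ b :=
  csInf_le ⟨s, fun _ h => h.2⟩ ⟨hb, hsb⟩

lemma gap_nonneg (hT : IsClosed T) {a b s : ℝ} (ha : a ∈ T) (hb : b ∈ T)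
    (hs : s ∈ Set.Icc a b) : 0 ≤ gap T s :=
  sub_nonneg.2 ((leftEnd_mem hT ha hs.1).2.trans (rightEnd_mem hT hb hs.2).2)

lemma gap_le {a b s : ℝ} (ha : a ∈ T) (hb : b ∈ T) (hs : s ∈ Set.Icc a b) :
    gap T s ≤ b - a :=
  sub_le_sub (rightEnd_le hb hs.2) (le_leftEnd ha hs.1)

/-- A nondegenerate gap is the graininess at its left end point. -/
lemma mu_leftEnd (hT : IsClosed T) {a b s : ℝ} (ha : a ∈ T) (hb : b ∈ T)
    (hs : s ∈ Set.Icc a b) (h : 0 < gap T s) :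
    leftEnd T s ∈ kappa T ∧ mu T (leftEnd T s) = gap T s := by
  have hl := leftEnd_mem hT ha hs.1
  have hr := rightEnd_mem hT hb hs.2
  have hlt : leftEnd T s < rightEnd T s := sub_pos.1 h
  refine ⟨mem_kappa_of_lt hl.1 hr.1 hlt, ?_⟩
  unfold mu gap
  congr 1
  refine le_antisymm (sigma_le hr.1 hlt) ?_
  have hne : (T ∩ Set.Ioi (leftEnd T s)).Nonempty := ⟨_, hr.1, hlt⟩
  rw [sigma, if_pos hne]
  refine le_csInf hne fun u hu => rightEnd_le hu.1 ?_
  by_contra! hus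
  exact (le_leftEnd hu.1 hus.le).not_gt hu.2

lemma gap_eq_mu (hT : IsClosed T) {t s : ℝ} (ht : t ∈ T)
    (hs : s ∈ Set.Ioo t (sigma T t)) : gap T s = mu T t := by
  have hlt : t < sigma T t := hs.1.trans hs.2
  have hσ := sigma_mem hT ht
  have hl : leftEnd T s = t := by
    refine le_antisymm ?_ (le_leftEnd ht hs.1.le)
    have hm := leftEnd_mem hT ht hs.1.le
    by_contra! hlt'
    exact (sigma_le hm.1 hlt').not_gt (hm.2.trans_lt hs.2)
  have hr : rightEnd T s = sigma T t := by
    refine le_antisymm (rightEnd_le hσ hs.2.le) ?_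
    have hm := rightEnd_mem hT hσ hs.2.le
    exact sigma_le hm.1 (hs.1.trans_le hm.2)
  rw [gap, hl, hr, mu]

/-- The gaps meeting `[a, b]` have a longest one: gap lengths are twice the distance from the
midpoint to `T`, and the distance to `T` attains its maximum on `[a, b]`. -/
lemma exists_gap_le (hT : IsClosed T) {a b : ℝ} (ha : a ∈ T) (hb : b ∈ T) (hab : a ≤ b) :
    ∃ m ∈ Set.Icc a b, ∀ s ∈ Set.Icc a b, gap T s ≤ gap T m := by
  obtain ⟨m, hm, hmax⟩ := isCompact_Icc.exists_isMaxOn (Set.nonempty_Icc.2 hab)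
    (Metric.continuous_infDist_pt T).continuousOn
  refine ⟨m, hm, fun s hs => ?_⟩
  have hl := leftEnd_mem hT ha hs.1
  have hr := rightEnd_mem hT hb hs.2
  have hlr : leftEnd T s ≤ rightEnd T s := hl.2.trans hr.2
  have hmid : (leftEnd T s + rightEnd T s) / 2 ∈ Set.Icc a b := by
    have := le_leftEnd ha hs.1
    have := rightEnd_le hb hs.2
    constructor <;> linarith
  have h1 : gap T s / 2 ≤ Metric.infDist ((leftEnd T s + rightEnd T s) / 2) T := by
    rw [Metric.le_infDist ⟨a, ha⟩]
    intro y hy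
    rw [Real.dist_eq, gap, le_abs]
    rcases le_total y s with h | h
    · have := le_leftEnd hy h
      left; linarith
    · have := rightEnd_le hy h
      right; linarith
  have h2 : Metric.infDist ((leftEnd T s + rightEnd T s) / 2) T ≤ Metric.infDist m T := hmax hmid
  have hml := leftEnd_mem hT ha hm.1
  have hmr := rightEnd_mem hT hb hm.2
  have h3 := Metric.infDist_le_dist_of_mem (x := m) hml.1
  have h4 := Metric.infDist_le_dist_of_mem (x := m) hmr.1
  rw [Real.dist_eq, abs_of_nonneg (sub_nonneg.2 hml.2)] at h3
  rw [Real.dist_eq, abs_of_nonpos (sub_nonpos.2 hmr.2)] at h4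
  unfold gap at h1 ⊢
  linarith

/-! ### The cylinder transformation and integrability -/

/-- The cylinder transformation `h ↦ log (1 + h p) / h`, with value `p` at `h = 0`. -/
noncomputable def cyl (p : ℝ) : ℝ → ℝ := dslope (fun h => Real.log (1 + h * p)) 0

lemma hasDerivAt_log_one_add_mul (p : ℝ) :
    HasDerivAt (fun h : ℝ => Real.log (1 + h * p)) p 0 := by
  have h1 : HasDerivAt (fun h : ℝ => 1 + h * p) p 0 := by
    simpa using ((hasDerivAt_id (0 : ℝ)).mul_const p).const_add 1
  simpa using h1.log (by simp)

lemma cyl_zero (p : ℝ) : cyl p 0 = p := by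
  rw [cyl, dslope_same, (hasDerivAt_log_one_add_mul p).deriv]

lemma mul_cyl (p h : ℝ) : h * cyl p h = Real.log (1 + h * p) := by
  simpa [cyl] using sub_smul_dslope (fun h : ℝ => Real.log (1 + h * p)) 0 h

lemma continuousAt_cyl_zero (p : ℝ) : ContinuousAt (cyl p) 0 :=
  continuousAt_dslope_same.2 (hasDerivAt_log_one_add_mul p).differentiableAt

lemma continuousAt_cyl {p h : ℝ} (hp : 1 + h * p ≠ 0) : ContinuousAt (cyl p) h := by
  rcases eq_or_ne h 0 with rfl | hne
  · exact continuousAt_cyl_zero p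
  · refine (continuousAt_dslope_of_ne hne).2 ?_
    exact ContinuousAt.log (by fun_prop) hp

lemma measurable_cyl (p : ℝ) : Measurable (cyl p) := by
  classical
  have : cyl p = fun h => if h = 0 then p else h⁻¹ * Real.log (1 + h * p) := by
    ext h
    split_ifs with h0
    · rw [h0, cyl_zero]
    · rw [← mul_cyl]
      field_simp
  rw [this]
  exact Measurable.ite (measurableSet_singleton 0) measurable_const (by fun_prop)

/-- Positive regressivity of the constant `p` controls all gaps in `[a, b]` at once, because there
is a longest one. -/
lemma exists_gap_bound (hT : IsClosed T) {p a b : ℝ}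
    (hp : ∀ t ∈ kappa T, 0 < 1 + mu T t * p) (ha : a ∈ T) (hb : b ∈ T) (hab : a ≤ b) :
    ∃ H, (∀ h ∈ Set.Icc 0 H, 0 < 1 + h * p) ∧ ∀ s ∈ Set.Icc a b, gap T s ≤ H := by
  obtain ⟨m, hm, hmax⟩ := exists_gap_le hT ha hb hab
  refine ⟨gap T m, fun h hh => ?_, hmax⟩
  rcases le_or_gt 0 p with h0 | h0
  · have := mul_nonneg hh.1 h0
    linarith
  · rcases hh.1.eq_or_lt with h1 | h1
    · rw [← h1]; norm_num
    obtain ⟨hk, hmu⟩ := mu_leftEnd hT ha hb hm (h1.trans_le hh.2)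
    have := hp _ hk
    rw [hmu] at this
    nlinarith [hh.2]

lemma aemeasurable_gap (hT : IsClosed T) {a b : ℝ} (ha : a ∈ T) (hb : b ∈ T) :
    AEMeasurable (gap T) (MeasureTheory.volume.restrict (Set.Icc a b)) := by
  refine AEMeasurable.sub ?_ ?_
  · refine aemeasurable_restrict_of_monotoneOn measurableSet_Icc fun s hs t ht hst => ?_
    have := rightEnd_mem hT hb ht.2
    exact rightEnd_le this.1 (hst.trans this.2)
  · refine aemeasurable_restrict_of_monotoneOn measurableSet_Icc fun s hs t ht hst => ?_
    have := leftEnd_mem hT ha hs.1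
    exact le_leftEnd this.1 (le_trans this.2 hst)

lemma intervalIntegrable_cyl_gap (hT : IsClosed T) {p a b : ℝ}
    (hp : ∀ t ∈ kappa T, 0 < 1 + mu T t * p) (ha : a ∈ T) (hb : b ∈ T) :
    IntervalIntegrable (fun s => cyl p (gap T s)) MeasureTheory.volume a b := by
  wlog hab : a ≤ b generalizing a b
  · exact (this hb ha (le_of_not_ge hab)).symm
  obtain ⟨H, hH, hgap⟩ := exists_gap_bound hT hp ha hb hab
  obtain ⟨C, hC⟩ := isCompact_Icc.exists_bound_of_continuousOn (s := Set.Icc 0 H) (f := cyl p)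
    fun h hh => (continuousAt_cyl (hH h hh).ne').continuousWithinAt
  rw [intervalIntegrable_iff_integrableOn_Icc_of_le hab]
  refine MeasureTheory.IntegrableOn.of_bound (by simp)
    ((measurable_cyl p).comp_aemeasurable (aemeasurable_gap hT ha hb)).aestronglyMeasurable C ?_
  refine MeasureTheory.ae_restrict_of_forall_mem measurableSet_Icc fun s hs => ?_
  exact hC _ ⟨gap_nonneg hT ha hb hs, hgap s hs⟩

/-! ### The exponential function -/

/-- Explicit form of `e_p(t, t₀)` for a constant positively regressive `p`. The integral of the
cylinder transformation of `p` over `T` is written as a Lebesgue integral over the real interval,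
in which a gap of length `h` contributes `h * cyl p h = log (1 + h p)`. -/
noncomputable def expFun (T : Set ℝ) (p t₀ t : ℝ) : ℝ :=
  Real.exp (∫ s in t₀..t, cyl p (gap T s))

lemma hasDerivWithinAt_integral_cyl_gap (hT : IsClosed T) {p t₀ t : ℝ}
    (hp : ∀ t ∈ kappa T, 0 < 1 + mu T t * p) (ht₀ : t₀ ∈ T) (ht : t ∈ T) :
    HasDerivWithinAt (fun t => ∫ s in t₀..t, cyl p (gap T s)) p T t := by
  rw [hasDerivWithinAt_iff_isLittleO, Asymptotics.isLittleO_iff]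
  intro ε hε
  obtain ⟨δ, hδ, hcyl⟩ := Metric.continuousAt_iff.1 (continuousAt_cyl_zero p) ε hε
  rw [eventually_nhdsWithin_iff, Metric.eventually_nhds_iff]
  refine ⟨δ, hδ, fun s hst hs => ?_⟩
  have hi {a b : ℝ} (ha : a ∈ T) (hb : b ∈ T) := intervalIntegrable_cyl_gap hT hp ha hb
  have hconst : (s - t) • p = ∫ _ in t..s, p := by simp
  rw [intervalIntegral.integral_interval_sub_left (hi ht₀ hs) (hi ht₀ ht), hconst,
    ← intervalIntegral.integral_sub (hi ht hs) intervalIntegrable_const, Real.norm_eq_abs (s - t)]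
  refine intervalIntegral.norm_integral_le_of_norm_le_const fun u hu => ?_
  -- a gap around a point between `s` and `t` is no longer than `|s - t|`
  have hgap : |gap T u| ≤ |s - t| := by
    rcases le_total t s with h | h
    · rw [Set.uIoc_of_le h] at hu
      have hu := Set.Ioc_subset_Icc_self hu
      rw [abs_of_nonneg (gap_nonneg hT ht hs hu), abs_of_nonneg (sub_nonneg.2 h)]
      exact gap_le ht hs hu
    · rw [Set.uIoc_of_ge h] at hu
      have hu := Set.Ioc_subset_Icc_self hu
      rw [abs_of_nonneg (gap_nonneg hT hs ht hu), abs_sub_comm, abs_of_nonneg (sub_nonneg.2 h)]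
      exact gap_le hs ht hu
  have := hcyl (x := gap T u) (by simpa [Real.dist_eq] using hgap.trans_lt hst)
  rw [cyl_zero, dist_eq_norm] at this
  exact this.le

lemma expFun_sigma (hT : IsClosed T) {p t₀ t : ℝ}
    (hp : ∀ t ∈ kappa T, 0 < 1 + mu T t * p) (ht₀ : t₀ ∈ T) (ht : t ∈ kappa T) :
    expFun T p t₀ (sigma T t) = (1 + mu T t * p) * expFun T p t₀ t := by
  have hi {a b : ℝ} (ha : a ∈ T) (hb : b ∈ T) := intervalIntegrable_cyl_gap hT hp ha hb
  have hσ := sigma_mem hT ht.1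
  have hint : ∫ s in t..sigma T t, cyl p (gap T s) = Real.log (1 + mu T t * p) := by
    rw [intervalIntegral.integral_congr_Ioo_of_le (g := fun _ => cyl p (mu T t)) (le_sigma T t)
      fun s hs => by simp only [gap_eq_mu hT ht.1 hs], intervalIntegral.integral_const,
      smul_eq_mul]
    exact mul_cyl p (mu T t)
  rw [expFun, ← intervalIntegral.integral_add_adjacent_intervals (hi ht₀ ht.1) (hi ht.1 hσ),
    hint, Real.exp_add, Real.exp_log (hp t ht), mul_comm, expFun]

lemma isExpSolution_expFun (hT : IsClosed T) {p t₀ : ℝ}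
    (hp : ∀ t ∈ kappa T, 0 < 1 + mu T t * p) (ht₀ : t₀ ∈ T) :
    IsExpSolution T (fun _ => p) t₀ (expFun T p t₀) := by
  refine ⟨by simp [expFun], fun t ht => ?_⟩
  have hd : HasDerivWithinAt (expFun T p t₀) (p * expFun T p t₀ t) T t := by
    rw [mul_comm]
    exact (hasDerivWithinAt_integral_cyl_gap hT hp ht₀ ht.1).exp
  rcases (le_sigma T t).eq_or_lt with hσ | hσ
  · exact (hasDeltaDeriv_iff_of_sigma_eq hσ.symm).2 hd
  · refine (hasDeltaDeriv_iff_of_lt_sigma ht.1 hσ).2 ⟨hd.continuousWithinAt, ?_⟩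
    rw [expFun_sigma hT hp ht₀ ht, smul_eq_mul]
    ring

/-- The reciprocal `v` of a nonvanishing solution of `y^Δ = p y` satisfies the adjoint equation
`v^Δ = -p v^σ`. -/
lemma HasDeltaDeriv.inv_exp {y : ℝ → ℝ} {p t : ℝ} (ht : t ∈ T) (hp : 1 + mu T t * p ≠ 0)
    (hy : ∀ s, y s ≠ 0) (h : HasDeltaDeriv T y (p * y t) t) :
    HasDeltaDeriv T (fun s => (y s)⁻¹) (-p * (y (sigma T t))⁻¹) t := by
  rcases (le_sigma T t).eq_or_lt with hσ | hσ
  · rw [hasDeltaDeriv_iff_of_sigma_eq hσ.symm] at h ⊢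
    rw [← hσ]
    have hd : HasDerivWithinAt (fun s => (y s)⁻¹) (-(p * y t) / y t ^ 2) T t := h.inv (hy t)
    have heq : -p * (y t)⁻¹ = -(p * y t) / y t ^ 2 := by
      have := hy t
      field_simp
    rwa [heq]
  · rw [hasDeltaDeriv_iff_of_lt_sigma ht hσ] at h ⊢
    refine ⟨h.1.inv₀ (hy t), ?_⟩
    have h2 : y (sigma T t) = (1 + mu T t * p) * y t := by
      rw [h.2, smul_eq_mul]; ring
    have := hy t
    rw [h2, smul_eq_mul]
    field_simp
    ring

/-- Forward uniqueness: the quotient of a solution by `expFun` has zero delta derivative. -/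
lemma IsExpSolution.eq_expFun (hT : IsClosed T) {p t₀ t : ℝ} {y : ℝ → ℝ}
    (hp : ∀ t ∈ kappa T, 0 < 1 + mu T t * p) (ht₀ : t₀ ∈ T) (ht : t ∈ T) (h : t₀ ≤ t)
    (hy : IsExpSolution T (fun _ => p) t₀ y) : y t = expFun T p t₀ t := by
  have hE := isExpSolution_expFun hT hp ht₀
  have hE0 : ∀ s, expFun T p t₀ s ≠ 0 := fun s => (Real.exp_pos _).ne'
  have hd : ∀ s ∈ kappa T, HasDeltaDeriv T (fun s => (expFun T p t₀ s)⁻¹ • y s) 0 s := by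
    intro s hs
    have := ((hE.2 s hs).inv_exp hs.1 (hp s hs).ne' hE0).smul hs.1 (hy.2 s hs)
    convert this using 1
    simp only [smul_eq_mul]
    ring
  have := eq_of_hasDeltaDeriv_zero hT ht₀ ht h hd
  simp only [smul_eq_mul, hE.1, hy.1] at this
  have h0 := hE0 t
  field_simp at this
  linarith

lemma expo_eq_expFun (hT : IsClosed T) {p t₀ t : ℝ}
    (hp : ∀ t ∈ kappa T, 0 < 1 + mu T t * p) (ht₀ : t₀ ∈ T) (ht : t ∈ T) (h : t₀ ≤ t) :
    expo T (fun _ => p) t t₀ = expFun T p t₀ t :=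
  (Classical.epsilon_spec ⟨_, isExpSolution_expFun hT hp ht₀⟩ :
    IsExpSolution T (fun _ => p) t₀ _).eq_expFun hT hp ht₀ ht h

/-! ### Comparison of the rates -/

lemma cyl_le_add {p q r h : ℝ} (hh : 0 ≤ h) (hp : 0 < 1 + h * p) (hq : 0 < 1 + h * q)
    (hr : 0 < 1 + h * r) (h0 : p ≤ q + r) (hpq : 1 + h * p ≤ (1 + h * q) * (1 + h * r)) :
    cyl p h ≤ cyl q h + cyl r h := by
  rcases hh.eq_or_lt with rfl | hpos
  · simpa only [cyl_zero] using h0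
  · refine le_of_mul_le_mul_left ?_ hpos
    rw [mul_add, mul_cyl, mul_cyl, mul_cyl, ← Real.log_mul hq.ne' hr.ne']
    exact Real.log_le_log hp hpq

/-- If `1 + μ p ≤ (1 + μ q) (1 + μ r)` along `T`, then `e_p ≤ e_q e_r` forward in time. The
hypothesis `p ≤ q + r` is the infinitesimal version, needed where `T` is dense. -/
lemma expFun_le_mul (hT : IsClosed T) {p q r t₀ t : ℝ}
    (hp : ∀ t ∈ kappa T, 0 < 1 + mu T t * p) (hq : ∀ t ∈ kappa T, 0 < 1 + mu T t * q)
    (hr : ∀ t ∈ kappa T, 0 < 1 + mu T t * r) (h0 : p ≤ q + r)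
    (hpq : ∀ t ∈ kappa T, 1 + mu T t * p ≤ (1 + mu T t * q) * (1 + mu T t * r))
    (ht₀ : t₀ ∈ T) (ht : t ∈ T) (h : t₀ ≤ t) :
    expFun T p t₀ t ≤ expFun T q t₀ t * expFun T r t₀ t := by
  have hiq := intervalIntegrable_cyl_gap hT hq ht₀ ht
  have hir := intervalIntegrable_cyl_gap hT hr ht₀ ht
  rw [expFun, expFun, expFun, ← Real.exp_add, ← intervalIntegral.integral_add hiq hir,
    Real.exp_le_exp]
  refine intervalIntegral.integral_mono_on h (intervalIntegrable_cyl_gap hT hp ht₀ ht)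
    (hiq.add hir) fun s hs => ?_
  rcases (gap_nonneg hT ht₀ ht hs).eq_or_lt with hg | hg
  · simpa only [← hg, cyl_zero] using h0
  · obtain ⟨hk, hmu⟩ := mu_leftEnd hT ht₀ ht hs hg
    rw [← hmu]
    exact cyl_le_add (mu_nonneg T _) (hp _ hk) (hq _ hk) (hr _ hk) h0 (hpq _ hk)

lemma posRegressive_const {p : ℝ} (hp : ∀ t ∈ kappa T, 0 < 1 + mu T t * p) :
    PosRegressive T (fun _ => p) :=
  ⟨⟨⟨fun _ _ _ => continuousWithinAt_const, fun _ _ _ => ⟨p, tendsto_const_nhds⟩⟩,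
    fun t ht => (hp t ht).ne'⟩, hp⟩

/-- If `x^Δ = A x`, then `z = e_α x` solves `z^Δ = (A (1 + μ α) + α I) z`. -/
lemma IsSolution.expFun_smul (hT : IsClosed T) {n : ℕ} {A : ℝ → Matrix (Fin n) (Fin n) ℝ}
    {α t₀ : ℝ} (hα : ∀ t ∈ kappa T, 0 < 1 + mu T t * α) (ht₀ : t₀ ∈ T)
    {x : ℝ → EuclideanSpace ℝ (Fin n)} (hx : IsSolution T A x) :
    IsSolution T (fun t => (1 + mu T t * α) • A t + α • (1 : Matrix (Fin n) (Fin n) ℝ))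
      (fun t => expFun T α t₀ t • x t) := by
  intro t ht
  convert ((isExpSolution_expFun hT hα ht₀).2 t ht).smul ht.1 (hx t ht) using 1
  rw [expFun_sigma hT hα ht₀ ht, map_add, map_smul, map_smul, LinearMap.add_apply,
    LinearMap.smul_apply, map_smul, LinearMap.smul_apply, Matrix.toLpLin_one, LinearMap.id_apply]
  module

end TimeScale

open TimeScale in
theorem lemma3p4 {n : ℕ} (T : Set ℝ) (hT : TimeScale.IsTimeScale T)
    (A : ℝ → Matrix (Fin n) (Fin n) ℝ)
    (hA_rd : TimeScale.MatrixRdContinuous T A)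
    (hA_reg : TimeScale.MatrixRegressive T A)
    (μmax : ℝ) (hμ : ∀ t ∈ T, TimeScale.mu T t ≤ μmax)
    (lam α : ℝ) (hlam : 0 < lam) (hα : 0 < α)
    (hlam_reg : TimeScale.PosRegressive T (fun _ => -lam))
    (hz : TimeScale.UniformlyExpStable T
      (fun t => (1 + TimeScale.mu T t * α) • A t + α • (1 : Matrix (Fin n) (Fin n) ℝ)) lam) :
    TimeScale.UniformlyExpStable T A ((lam + α) / (1 + μmax * α)) := by
  have hcl := hT.isClosed
  obtain ⟨τ, hτ⟩ := hT.nonempty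
  have hmax : 0 ≤ μmax := (mu_nonneg T τ).trans (hμ τ hτ)
  have hden : 0 < 1 + μmax * α := by positivity
  set r := (lam + α) / (1 + μmax * α) with hr
  have hr0 : 0 < r := by positivity
  have hrmul : r * (1 + μmax * α) = lam + α := div_mul_cancel₀ _ hden.ne'
  have hlam' : ∀ t ∈ kappa T, 0 < 1 + mu T t * -lam := hlam_reg.2
  have hα' : ∀ t ∈ kappa T, 0 < 1 + mu T t * α := fun t _ => by
    have := mul_nonneg (mu_nonneg T t) hα.le
    linarith
  have hrμ : ∀ t ∈ kappa T, r * (1 + mu T t * α) ≤ lam + α := fun t ht => by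
    rw [← hrmul]
    have := hμ t ht.1
    gcongr
  have hle : ∀ t ∈ kappa T, 1 + mu T t * -lam ≤ (1 + mu T t * α) * (1 + mu T t * -r) :=
    fun t ht => by
      have := mul_le_mul_of_nonneg_left (hrμ t ht) (mu_nonneg T t)
      linarith
  have hr' : ∀ t ∈ kappa T, 0 < 1 + mu T t * -r := fun t ht =>
    pos_of_mul_pos_right ((hlam' t ht).trans_le (hle t ht)) (hα' t ht).le
  have hle0 : -lam ≤ α + -r := by nlinarith [mul_nonneg hr0.le (mul_nonneg hmax hα.le)]
  obtain ⟨-, -, γ, hγ, hbound⟩ := hz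
  refine ⟨hr0, posRegressive_const hr', γ, hγ, fun t₀ ht₀ x₀ x hx hx₀ t ht htt => ?_⟩
  have hE0 : 0 < expFun T α t₀ t := Real.exp_pos _
  have hzt := hbound t₀ ht₀ x₀ _ (hx.expFun_smul hcl hα' ht₀) (by simp [expFun, hx₀]) t ht htt
  rw [expo_eq_expFun hcl hlam' ht₀ ht htt, norm_smul, Real.norm_eq_abs, abs_of_pos hE0] at hzt
  rw [expo_eq_expFun hcl hr' ht₀ ht htt]
  have hcmp := expFun_le_mul hcl hlam' hα' hr' hle0 hle ht₀ ht htt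
  refine le_of_mul_le_mul_left (hzt.trans ?_) hE0
  calc γ * expFun T (-lam) t₀ t * ‖x₀‖
      ≤ γ * (expFun T α t₀ t * expFun T (-r) t₀ t) * ‖x₀‖ := by gcongr
    _ = expFun T α t₀ t * (γ * expFun T (-r) t₀ t * ‖x₀‖) := by ring
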